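/- Let $X$ be a non-reflexive (real or complex) Banach space and let $n \in \mathbb{N}$. Then there is a convex subset $B \subseteq X^*$ of order $n$. Here, for $A \subseteq X^*$, the weak$^*$ derived set of $A$ is $$A^{(1)} = \bigcup_{m=1}^{\infty} \overline{A \cap m B_{X^*}}^{\,w^*},$$ where $B_{X^*}$ is the closed unit ball of $X^*$. One sets $A^{(0)} = A$, $A^{(\alpha+1)} = (A^{(\alpha)})^{(1)}$ for every ordinal $\alpha$, and $A^{(\alpha)} = \bigcup_{\beta<\alpha} A^{(\beta)}$ for every limit ordinal $\alpha$. The order of $A$ is the least ordinal $\alpha$ such that $A^{(\alpha)} = A^{(\alpha+1)}$. -/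

import Mathlib

universe u v w

noncomputable section

/-- A normed space is reflexive if the canonical embedding into its bidual is surjective. -/
def IsReflexiveSpace (𝕜 : Type v) [RCLike 𝕜] (X : Type u) [NormedAddCommGroup X]
    [NormedSpace 𝕜 X] : Prop :=
  Function.Surjective (NormedSpace.inclusionInDoubleDual 𝕜 X)

/-- The weak* derived set of a subset `A` of the dual `X*`: the union over `m` of the weak*
closures of `A ∩ m B_{X*}`, where `B_{X*}` is the closed unit ball of the dual norm.  The type
`WeakDual 𝕜 X` is `X*` with its weak* topology, so `closure` is the weak* closure.  (The sets
increase with `m`, so that the term `m = 0` adds nothing to the union over `m ≥ 1`.) -/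
def weakStarDerived {𝕜 : Type v} [RCLike 𝕜] {X : Type u} [NormedAddCommGroup X]
    [NormedSpace 𝕜 X] (A : Set (WeakDual 𝕜 X)) : Set (WeakDual 𝕜 X) :=
  ⋃ m : ℕ, closure (A ∩ WeakDual.toStrongDual ⁻¹' Metric.closedBall 0 (m : ℝ))

/-- The weak* derived set `A^(α)` of order `α`: `A^(0) = A`, `A^(α + 1) = (A^(α))^(1)`, and
`A^(α)` is the union of the `A^(β)`, `β < α`, for a limit ordinal `α`. -/
def weakStarDerivedIter {𝕜 : Type v} [RCLike 𝕜] {X : Type u} [NormedAddCommGroup X]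
    [NormedSpace 𝕜 X] (A : Set (WeakDual 𝕜 X)) (α : Ordinal.{w}) : Set (WeakDual 𝕜 X) :=
  Ordinal.limitRecOn (motive := fun _ => Set (WeakDual 𝕜 X)) α A
    (fun _ S => weakStarDerived S)
    (fun a _ S => ⋃ (b : Ordinal.{w}) (hb : b < a), S b hb)

/-- `A` has (weak* derived-set) order `α`: `α` is the least ordinal with `A^(α) = A^(α + 1)`. -/
def HasWeakStarOrder {𝕜 : Type v} [RCLike 𝕜] {X : Type u} [NormedAddCommGroup X]
    [NormedSpace 𝕜 X] (A : Set (WeakDual 𝕜 X)) (α : Ordinal.{max u v}) : Prop :=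
  IsLeast {β : Ordinal.{max u v} | weakStarDerivedIter A β = weakStarDerivedIter A (β + 1)} α

section

variable {𝕜 : Type v} [RCLike 𝕜] {X : Type u} [NormedAddCommGroup X] [NormedSpace 𝕜 X]

theorem weakStarDerivedIter_zero (A : Set (WeakDual 𝕜 X)) :
    weakStarDerivedIter A (0 : Ordinal.{w}) = A := by
  simp [weakStarDerivedIter, Ordinal.limitRecOn_zero]

theorem weakStarDerivedIter_add_one (A : Set (WeakDual 𝕜 X)) (α : Ordinal.{w}) :
    weakStarDerivedIter A (α + 1) = weakStarDerived (weakStarDerivedIter A α) := by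
  simp [weakStarDerivedIter, Ordinal.limitRecOn_add_one]

theorem weakStarDerivedIter_limit (A : Set (WeakDual 𝕜 X)) {α : Ordinal.{w}}
    (h : Order.IsSuccLimit α) :
    weakStarDerivedIter A α = ⋃ (β : Ordinal.{w}) (_ : β < α), weakStarDerivedIter A β := by
  simp only [weakStarDerivedIter]
  rw [Ordinal.limitRecOn_limit _ _ _ _ h]

end

end

/-!
A sequence `f n` of functionals on `X` on whose positive combinations the dual norm is equivalent to
the `ℓ¹`-norm of the coefficients, and which is weak* null on a suitable subspace, transports
questions about derived sets in the positive cone of `ℓ¹`, with pointwise limits of bounded nets, to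
questions about weak* derived sets in `X*`.

Non-reflexivity provides such a sequence (`exists_isTriangularSystem`): if `F` in the bidual does not
come from `X`, there are functionals `f n` of norm at most `1` and bounded vectors `x k` with
`f n (x k) = 0` for `k < n` and `re (f n (x k)) ≥ δ > 0` for `n ≤ k`.  A set `C` in the positive cone
of `ℓ¹` gives the set `dualLift f x C` of the functionals that agree with `∑ n, a n • f n` on all
`x k`, for some `a ∈ C`.  By `IsTriangularSystem.weakStarDerived_dualLift`, the weak* derived set of
`dualLift f x C` is the lift of the set `boundedLimits C` of bounded pointwise limits, and by
`IsTriangularSystem.dualLift_injOn` the lift determines `C`.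

It remains to find a convex set of order `n` in the positive cone of `ℓ¹`, indexed by levels `i` and
positions `j`.  In `tower n`, level `0` has mass at least `1`, for `i + 1 < n` the sum
`∑ j, (j + 1) * a i j` is at most the mass of level `i + 1`, and for `i = n - 1` it is finite.  A
bound on the masses keeps the mass of every level but the last from escaping to infinity, while the
mass of the last level can escape.  A derivation therefore removes one level of the constraints:
`boundedLimits (tower (k + 1)) = tower k`.  These sets are distinct, and `tower 0`, the whole cone,
is stable.
-/

noncomputable section

open scoped NNReal ENNReal
open Filter Topology

/-! ### Bounded pointwise limits in the positive cone of `ℓ¹` -/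

section BoundedLimits

/-- The `ℓ¹`-norm of a nonnegative family, with value `∞` when the family is not summable. -/
def mass (a : ℕ → ℝ≥0) : ℝ≥0∞ := ∑' n, (a n : ℝ≥0∞)

/-- The total mass of level `i`.  A family indexed by `ℕ` is read as a family indexed by `ℕ × ℕ`
through `Nat.pair`; the first coordinate is the level and the second the position in it. -/
def levelSum (a : ℕ → ℝ≥0) (i : ℕ) : ℝ≥0∞ := ∑' j, (a (Nat.pair i j) : ℝ≥0∞)

/-- The lower bound imposed on the mass of level `i`: the constant `1` for level `0`, and for level
`i + 1` the sum over level `i` with the weight `j + 1` at position `j`.  The weights tend to `∞`, so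
a bound on the weighted sum over a level keeps the mass of that level from escaping to infinity. -/
def weightedSum (a : ℕ → ℝ≥0) : ℕ → ℝ≥0∞
  | 0 => 1
  | i + 1 => ∑' j : ℕ, ((j : ℝ≥0∞) + 1) * a (Nat.pair i j)

/-- The summable families whose levels below `k` have at least the mass that `weightedSum` requires,
and for which the mass required of level `k` is finite.  Passing from
`tower (k + 1)` to bounded pointwise limits weakens the constraint on level `k` to finiteness of the
required mass and preserves those on the lower levels, so `tower k` has order `k`. -/
def tower (k : ℕ) : Set (ℕ → ℝ≥0) :=
  {a | mass a ≠ ∞ ∧ (∀ i < k, weightedSum a i ≤ levelSum a i) ∧ weightedSum a k ≠ ∞}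

/-- The analogue, for families in the positive cone of `ℓ¹` with the topology of pointwise
convergence, of the weak* derived set: the limits of nets in `C` of bounded mass. -/
def boundedLimits (C : Set (ℕ → ℝ≥0)) : Set (ℕ → ℝ≥0) :=
  ⋃ m : ℕ, closure (C ∩ {a | mass a ≤ m})

theorem levelSum_le_mass (a : ℕ → ℝ≥0) (i : ℕ) : levelSum a i ≤ mass a :=
  ENNReal.tsum_comp_le_tsum_of_injective (f := Nat.pair i)
    (fun _ _ h => (Nat.pair_eq_pair.1 h).2) (fun n => (a n : ℝ≥0∞))

theorem convex_tower (k : ℕ) : Convex ℝ≥0 (tower k) := by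
  intro a ha b hb s t _ _ hst
  have hst' : (s : ℝ≥0∞) + t = 1 := by exact_mod_cast hst
  have hS : ∀ i, levelSum (s • a + t • b) i = s * levelSum a i + t * levelSum b i := fun i => by
    simp [levelSum, ENNReal.tsum_add, ENNReal.tsum_mul_left]
  have hM : mass (s • a + t • b) = s * mass a + t * mass b := by
    simp [mass, ENNReal.tsum_add, ENNReal.tsum_mul_left]
  have hW : ∀ i, weightedSum (s • a + t • b) i = s * weightedSum a i + t * weightedSum b i := by
    rintro (_ | i)
    · simp [weightedSum, hst']
    · simp only [weightedSum, ← ENNReal.tsum_mul_left, ← ENNReal.tsum_add]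
      refine tsum_congr fun j => ?_
      simp only [Pi.add_apply, Pi.smul_apply, smul_eq_mul, ENNReal.coe_add, ENNReal.coe_mul]
      ring
  refine ⟨?_, fun i hi => ?_, ?_⟩
  · rw [hM]
    exact ENNReal.add_ne_top.2
      ⟨ENNReal.mul_ne_top (by simp) ha.1, ENNReal.mul_ne_top (by simp) hb.1⟩
  · rw [hW, hS]
    gcongr
    · exact ha.2.1 i hi
    · exact hb.2.1 i hi
  · rw [hW]
    exact ENNReal.add_ne_top.2
      ⟨ENNReal.mul_ne_top (by simp) ha.2.2, ENNReal.mul_ne_top (by simp) hb.2.2⟩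

theorem continuous_coord (n : ℕ) : Continuous fun a : ℕ → ℝ≥0 => (a n : ℝ≥0∞) :=
  ENNReal.continuous_coe.comp (continuous_apply n)

theorem lowerSemicontinuous_mass : LowerSemicontinuous mass :=
  lowerSemicontinuous_tsum fun n => (continuous_coord n).lowerSemicontinuous

theorem lowerSemicontinuous_weightedSum (i : ℕ) :
    LowerSemicontinuous fun a => weightedSum a i := by
  cases i with
  | zero => exact lowerSemicontinuous_const
  | succ i =>
    exact lowerSemicontinuous_tsum fun j =>
      ((ENNReal.continuous_const_mul (by simp)).comp
        (continuous_coord (Nat.pair i j))).lowerSemicontinuous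

theorem isClosed_mass_le (m : ℝ≥0∞) : IsClosed {a | mass a ≤ m} :=
  lowerSemicontinuous_mass.isClosed_preimage m

/-- Markov's inequality for the weights `j + 1`: at most `weightedSum a (i + 1) / (N + 1)` of the
mass of level `i` lies at positions `j ≥ N`. -/
theorem levelSum_le_sum_add (a : ℕ → ℝ≥0) (i N : ℕ) :
    levelSum a i ≤ ∑ j ∈ Finset.range N, (a (Nat.pair i j) : ℝ≥0∞)
      + weightedSum a (i + 1) / (N + 1) := by
  have h : ∀ j : ℕ, (a (Nat.pair i j) : ℝ≥0∞) ≤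
      (if j ∈ Finset.range N then (a (Nat.pair i j) : ℝ≥0∞) else 0)
        + (((j : ℝ≥0∞) + 1) * a (Nat.pair i j)) / (N + 1) := fun j => by
    split_ifs with hj
    · exact le_self_add
    · rw [zero_add, ENNReal.le_div_iff_mul_le (by simp) (by simp), mul_comm]
      have : N ≤ j := by simpa using hj
      gcongr
  calc levelSum a i ≤ _ := ENNReal.tsum_le_tsum h
    _ = _ := by
      rw [ENNReal.tsum_add]
      simp only [div_eq_mul_inv, ENNReal.tsum_mul_right, weightedSum]
      rw [tsum_eq_sum (s := Finset.range N) fun j hj => if_neg hj]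
      congr 1
      exact Finset.sum_congr rfl fun j hj => if_pos hj

/-- In `tower (k + 1)` the weighted sum over a level below `k` is dominated by the mass of the next
level.  On sets of bounded mass these levels are therefore uniformly tight: their total masses are
continuous and the constraints on them survive in the limit, the left-hand sides being lower
semicontinuous. -/
theorem boundedLimits_tower_succ_subset (k : ℕ) : boundedLimits (tower (k + 1)) ⊆ tower k := by
  intro a ha
  obtain ⟨m, hm⟩ := Set.mem_iUnion.1 ha
  have hmass : mass a ≤ m :=
    closure_minimal Set.inter_subset_right (isClosed_mass_le m) hm
  have hW : ∀ c ∈ tower (k + 1) ∩ {a | mass a ≤ (m : ℝ≥0∞)}, ∀ i ≤ k, weightedSum c i ≤ m :=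
    fun c hc i hi => (hc.1.2.1 i (by omega)).trans ((levelSum_le_mass c i).trans hc.2)
  refine ⟨ne_top_of_le_ne_top (by simp) hmass, fun i hi => ?_, ?_⟩
  · have key : ∀ N : ℕ, weightedSum a i ≤ levelSum a i + m / (N + 1) := fun N => by
      -- Only finitely many positions of level `i` enter, so the right-hand side is continuous.
      have hcl : IsClosed {c : ℕ → ℝ≥0 | weightedSum c i ≤
          ∑ j ∈ Finset.range N, (c (Nat.pair i j) : ℝ≥0∞) + m / (N + 1)} :=
        (lowerSemicontinuous_weightedSum i).isClosed_epigraph.preimage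
          (continuous_id.prodMk ((continuous_finsetSum _ fun j _ =>
            continuous_coord (Nat.pair i j)).add continuous_const))
      refine (closure_minimal ?_ hcl hm : _ ≤ _).trans ?_
      · intro c hc
        refine (hc.1.2.1 i (by omega)).trans ((levelSum_le_sum_add c i N).trans ?_)
        gcongr
        exact hW c hc _ hi
      · gcongr
        exact ENNReal.sum_le_tsum _
    have hlim : Tendsto (fun N : ℕ => levelSum a i + (m : ℝ≥0∞) / ((N : ℝ≥0∞) + 1)) atTop
        (𝓝 (levelSum a i + 0)) := by
      refine tendsto_const_nhds.add ?_
      have h := ENNReal.Tendsto.const_div (a := (m : ℝ≥0∞))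
        ((tendsto_add_atTop_iff_nat 1).2 ENNReal.tendsto_nat_nhds_top)
        (Or.inr (ENNReal.natCast_ne_top m))
      simpa using h
    simpa using ge_of_tendsto' hlim key
  · refine ne_top_of_le_ne_top (ENNReal.natCast_ne_top m) ?_
    exact closure_minimal (fun c hc => hW c hc k le_rfl)
      ((lowerSemicontinuous_weightedSum k).isClosed_preimage (m : ℝ≥0∞)) hm

/-- The family `a` with the entries of level `k` beyond `N` deleted and the mass `V` placed at
position `N` of that level. -/
def moveMass (a : ℕ → ℝ≥0) (k : ℕ) (V : ℝ≥0) (N : ℕ) (n : ℕ) : ℝ≥0 :=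
  (if (Nat.unpair n).1 = k ∧ N ≤ (Nat.unpair n).2 then 0 else a n)
    + if n = Nat.pair k N then V else 0

theorem mass_moveMass_le (a : ℕ → ℝ≥0) (k : ℕ) (V : ℝ≥0) (N : ℕ) :
    mass (moveMass a k V N) ≤ mass a + V := by
  calc mass (moveMass a k V N)
      ≤ ∑' n, ((a n : ℝ≥0∞) + if n = Nat.pair k N then (V : ℝ≥0∞) else 0) := by
        refine ENNReal.tsum_le_tsum fun n => ?_
        simp only [moveMass, ENNReal.coe_add]
        refine add_le_add ?_ ?_ <;> split_ifs <;> simp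
    _ = _ := by rw [ENNReal.tsum_add, tsum_ite_eq, mass]

theorem moveMass_pair_of_ne (a : ℕ → ℝ≥0) {i k : ℕ} (V : ℝ≥0) (N j : ℕ) (h : i ≠ k) :
    moveMass a k V N (Nat.pair i j) = a (Nat.pair i j) := by
  simp [moveMass, h, Nat.pair_eq_pair]

theorem tendsto_moveMass (a : ℕ → ℝ≥0) (k : ℕ) (V : ℝ≥0) :
    Tendsto (moveMass a k V) atTop (𝓝 a) := by
  refine tendsto_pi_nhds.2 fun n => tendsto_const_nhds.congr' ?_
  filter_upwards [eventually_gt_atTop (Nat.unpair n).2] with N hN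
  have h1 : ¬ N ≤ (Nat.unpair n).2 := by omega
  have h2 : n ≠ Nat.pair k N := by rintro rfl; simp at hN
  simp [moveMass, h1, h2]

/-- The constraint on level `k` can be met by putting the required mass further and further out in
that level; in the pointwise limit it disappears. -/
theorem tower_subset_boundedLimits_succ (k : ℕ) : tower k ⊆ boundedLimits (tower (k + 1)) := by
  intro a ha
  obtain ⟨V, hV⟩ : ∃ V : ℝ≥0, (V : ℝ≥0∞) = weightedSum a k :=
    ⟨_, ENNReal.coe_toNNReal ha.2.2⟩
  have hfin : mass a + V ≠ ∞ := ENNReal.add_ne_top.2 ⟨ha.1, by simp⟩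
  obtain ⟨m, hm⟩ := ENNReal.exists_nat_gt hfin
  refine Set.mem_iUnion.2 ⟨m, mem_closure_of_tendsto (tendsto_moveMass a k V)
    (Eventually.of_forall fun N => ?_)⟩
  have hle := (mass_moveMass_le a k V N)
  have hWle : ∀ i ≤ k, weightedSum (moveMass a k V N) i = weightedSum a i := by
    rintro (_ | i) hi
    · rfl
    · simp only [weightedSum]
      refine tsum_congr fun j => ?_
      rw [moveMass_pair_of_ne a V N j (by omega)]
  refine ⟨⟨ne_top_of_le_ne_top hfin hle, fun i hi => ?_, ?_⟩, hle.trans hm.le⟩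
  · rw [hWle i (by omega)]
    rcases (Nat.lt_succ_iff_lt_or_eq.1 hi) with hi | rfl
    · refine (ha.2.1 i hi).trans_eq (tsum_congr fun j => ?_)
      rw [moveMass_pair_of_ne a V N j hi.ne]
    · rw [← hV]
      refine le_trans ?_ (ENNReal.le_tsum N)
      simp [moveMass]
  -- Level `k` of the modified family is supported on positions `j ≤ N`.
  · simp only [weightedSum]
    rw [tsum_eq_sum (s := Finset.range (N + 1))]
    · exact ENNReal.sum_ne_top.2 fun j _ =>
        ENNReal.mul_ne_top (ENNReal.add_ne_top.2 ⟨by simp, by simp⟩) (by simp)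
    · intro j hj
      have : N + 1 ≤ j := by simpa using hj
      have h1 : N ≤ j := by omega
      have h2 : j ≠ N := by omega
      simp [moveMass, h1, h2, Nat.pair_eq_pair]

theorem boundedLimits_tower_succ (k : ℕ) : boundedLimits (tower (k + 1)) = tower k :=
  (boundedLimits_tower_succ_subset k).antisymm (tower_subset_boundedLimits_succ k)

theorem mem_tower_zero {a : ℕ → ℝ≥0} : a ∈ tower 0 ↔ mass a ≠ ∞ := by
  simp [tower, weightedSum]

theorem boundedLimits_tower_zero : boundedLimits (tower 0) = tower 0 := by
  ext a
  simp only [boundedLimits, Set.mem_iUnion, mem_tower_zero]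
  refine ⟨fun ⟨m, hm⟩ => ?_, fun ha => ?_⟩
  · exact ne_top_of_le_ne_top (ENNReal.natCast_ne_top m)
      (closure_minimal Set.inter_subset_right (isClosed_mass_le (m : ℝ≥0∞)) hm)
  · obtain ⟨m, hm⟩ := ENNReal.exists_nat_gt ha
    exact ⟨m, subset_closure ⟨mem_tower_zero.2 ha, hm.le⟩⟩

theorem tower_succ_ne (k : ℕ) : tower (k + 1) ≠ tower k := by
  -- One unit of mass at the first position of each level below `k`, and nothing at level `k`.
  let a : ℕ → ℝ≥0 := fun n => if (Nat.unpair n).1 < k ∧ (Nat.unpair n).2 = 0 then 1 else 0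
  have hS : ∀ i, levelSum a i = if i < k then 1 else 0 := fun i => by
    rw [levelSum, tsum_eq_single 0]
    · by_cases h : i < k <;> simp [a, h]
    · intro j hj; simp [a, hj]
  have hW : ∀ i ≤ k, weightedSum a i = 1 := by
    rintro (_ | i) hi
    · rfl
    · rw [weightedSum, tsum_eq_single 0]
      · simp [a, Nat.lt_of_succ_le hi]
      · intro j hj; simp [a, hj]
  have hM : mass a ≠ ∞ := by
    rw [mass, tsum_eq_sum (s := (Finset.range k).image fun i => Nat.pair i 0)]
    · exact ENNReal.sum_ne_top.2 fun _ _ => ENNReal.coe_ne_top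
    · intro n hn
      by_contra h
      refine hn (Finset.mem_image.2 ⟨(Nat.unpair n).1, ?_⟩)
      have h' : (Nat.unpair n).1 < k ∧ (Nat.unpair n).2 = 0 := by
        by_contra h'
        simp [a, h'] at h
      exact ⟨Finset.mem_range.2 h'.1, by rw [← h'.2, Nat.pair_unpair]⟩
  intro h
  have ha : a ∈ tower k :=
    ⟨hM, fun i hi => by rw [hS, hW i hi.le, if_pos hi], by simp [hW k le_rfl]⟩
  -- Membership in `tower (k + 1)` would require the mass of level `k` to be at least `1`.
  have := (h ▸ ha : a ∈ tower (k + 1)).2.1 k (by omega)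
  simp [hS, hW k le_rfl] at this

end BoundedLimits

/-! ### Triangular systems in non-reflexive spaces -/

section TriangularSystem

variable {𝕜 : Type v} [RCLike 𝕜] {X : Type u} [NormedAddCommGroup X] [NormedSpace 𝕜 X]

open NormedSpace RCLike

/-- **Goldstine's theorem** for finitely many functionals: on a finite set of functionals, an
element `F` of the bidual is approximated by vectors of norm at most `‖F‖`. -/
theorem exists_norm_le_forall_norm_sub_lt (F : StrongDual 𝕜 (StrongDual 𝕜 X))
    (s : Finset (StrongDual 𝕜 X)) {ε : ℝ} (hε : 0 < ε) :
    ∃ x : X, ‖x‖ ≤ ‖F‖ ∧ ∀ f ∈ s, ‖f x - F f‖ < ε := by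
  classical
  let T : X →L[𝕜] (s → 𝕜) := ContinuousLinearMap.pi fun f => (f : StrongDual 𝕜 X)
  let c : s → 𝕜 := fun f => F f
  have hc : c ∈ closure (T '' Metric.closedBall 0 ‖F‖) := by
    by_contra hc
    have hconv : Convex ℝ (closure (T '' Metric.closedBall 0 ‖F‖)) := by
      let _ := NormedSpace.restrictScalars ℝ 𝕜 X
      refine Convex.closure ?_
      exact (convex_closedBall (0 : X) ‖F‖).linear_image (T.restrictScalars ℝ).toLinearMap
    obtain ⟨φ, u, hu, hu'⟩ := RCLike.geometric_hahn_banach_closed_point (𝕜 := 𝕜) hconv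
      isClosed_closure hc
    let α : s → 𝕜 := fun f => φ (Pi.single f 1)
    have hφ : ∀ y, φ y = ∑ f, y f * α f := fun y => by
      conv_lhs => rw [pi_eq_sum_univ' y]
      simp [α, map_sum]
    -- The separating functional on `s → 𝕜` is evaluation at a linear combination of members of `s`.
    let g : StrongDual 𝕜 X := ∑ f : s, α f • (f : StrongDual 𝕜 X)
    have hg : ∀ x, φ (T x) = g x := fun x => by
      simp [hφ, g, T, mul_comm]
    have hFg : φ c = F g := by
      simp [hφ, g, c, mul_comm, map_sum]
    have hu0 : 0 ≤ u := by
      have := hu 0 (subset_closure ⟨0, Metric.mem_closedBall_self (norm_nonneg F), map_zero T⟩)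
      simpa using this.le
    have hnorm : ‖(‖F‖ : 𝕜) • g‖ ≤ u := by
      refine ContinuousLinearMap.opNorm_le_bound _ hu0 fun x => ?_
      rcases eq_or_ne x 0 with rfl | hx
      · simp
      -- Test `hu` on the multiple of `x` of norm `‖F‖` at which `g` is real and nonnegative.
      obtain ⟨z, hz, hzx⟩ := RCLike.exists_norm_eq_mul_self (g x)
      have hx' : 0 < ‖x‖ := norm_pos_iff.2 hx
      have := hu (T (((‖F‖ / ‖x‖ : ℝ) : 𝕜) • z • x)) (subset_closure ⟨_, by
        rw [mem_closedBall_zero_iff, norm_smul, norm_smul, hz, one_mul, RCLike.norm_ofReal,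
          abs_of_nonneg (div_nonneg (norm_nonneg F) hx'.le), div_mul_cancel₀ _ hx'.ne'], rfl⟩)
      rw [hg, g.map_smul, g.map_smul, smul_eq_mul, smul_eq_mul, ← hzx, ← RCLike.ofReal_mul,
        RCLike.ofReal_re, div_mul_eq_mul_div, div_lt_iff₀ hx'] at this
      rw [smul_apply, norm_smul, RCLike.norm_ofReal,
        abs_of_nonneg (norm_nonneg F)]
      exact this.le
    have h1 : re (F g) ≤ ‖F‖ * ‖g‖ := (RCLike.re_le_norm _).trans (F.le_opNorm g)
    rw [norm_smul, RCLike.norm_ofReal, abs_of_nonneg (norm_nonneg F)] at hnorm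
    rw [hFg] at hu'
    linarith
  obtain ⟨_, ⟨x, hx, rfl⟩, hxε⟩ := Metric.mem_closure_iff.1 hc ε hε
  refine ⟨x, by simpa using hx, fun f hf => ?_⟩
  rw [dist_comm, dist_pi_lt_iff hε] at hxε
  simpa [T, c, dist_eq_norm] using hxε ⟨f, hf⟩

/-- An element of the bidual at distance more than `θ` from `X` has norm more than `θ` on the
annihilator of each finite set: an element of the bidual that agrees with `F` there differs from
`F` by an element of `X`. -/
theorem exists_annihilator_apply_eq (F : StrongDual 𝕜 (StrongDual 𝕜 X)) {θ : ℝ} (hθ : 0 < θ)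
    (hF : ∀ y : X, θ < ‖F - inclusionInDoubleDual 𝕜 X y‖) (s : Finset X) :
    ∃ f : StrongDual 𝕜 X, ‖f‖ ≤ 1 ∧ F f = θ ∧ ∀ x ∈ s, f x = 0 := by
  let L : s → StrongDual 𝕜 X →ₗ[𝕜] 𝕜 := fun x => (inclusionInDoubleDual 𝕜 X x).toLinearMap
  let p : Submodule 𝕜 (StrongDual 𝕜 X) := ⨅ x, LinearMap.ker (L x)
  have hp : ∀ g ∈ p, ∀ x ∈ s, g x = 0 := fun g hg x hx => by
    simpa [L] using (Submodule.mem_iInf _).1 hg ⟨x, hx⟩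
  have hex : ∃ g ∈ p, θ * ‖g‖ < ‖F g‖ := by
    by_contra! hle
    obtain ⟨G, hG, hGn⟩ := exists_extension_norm_eq p (F.comp p.subtypeL)
    have hGθ : ‖G‖ ≤ θ := by
      rw [hGn]
      exact ContinuousLinearMap.opNorm_le_bound _ hθ.le fun g => hle g g.2
    have hspan : (F - G).toLinearMap ∈ Submodule.span 𝕜 (Set.range L) := by
      refine mem_span_of_iInf_ker_le_ker fun g hg => ?_
      have := hG ⟨g, hg⟩
      simp at this
      simp [this]
    obtain ⟨c, hc⟩ := (Submodule.mem_span_range_iff_exists_fun 𝕜).1 hspan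
    have hy : F - G = inclusionInDoubleDual 𝕜 X (∑ x, c x • (x : X)) := by
      ext g
      have := LinearMap.congr_fun hc g
      simp [L] at this
      simp [← this]
    refine (hF (∑ x, c x • (x : X))).not_ge ?_
    have : F - inclusionInDoubleDual 𝕜 X (∑ x, c x • (x : X)) = G := by rw [← hy]; abel
    rwa [this]
  obtain ⟨g, hg, hlt⟩ := hex
  have hpos : 0 < ‖F g‖ := lt_of_le_of_lt (by positivity) hlt
  refine ⟨((θ : 𝕜) / F g) • g, ?_, ?_, fun x hx => by simp [hp g hg x hx]⟩
  · rw [norm_smul, norm_div, RCLike.norm_ofReal, abs_of_pos hθ, div_mul_eq_mul_div,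
      div_le_one hpos]
    exact hlt.le
  · rw [map_smul, smul_eq_mul, div_mul_cancel₀ _ (norm_pos_iff.1 hpos)]

/-- A sequence of functionals `f n` in the unit ball of the dual and a bounded sequence of vectors
`x k` such that the matrix `f n (x k)` vanishes for `k < n`, and has real parts bounded below by a
positive constant for `n ≤ k`. -/
structure IsTriangularSystem (f : ℕ → StrongDual 𝕜 X) (x : ℕ → X) (R δ : ℝ) : Prop where
  norm_functional_le : ∀ n, ‖f n‖ ≤ 1
  norm_vector_le : ∀ k, ‖x k‖ ≤ R
  pos : 0 < δ
  apply_eq_zero : ∀ k n, k < n → f n (x k) = 0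
  le_re_apply : ∀ n k, n ≤ k → δ ≤ re (f n (x k))

/-- The construction of R. C. James: for `F` in the bidual at positive distance from `X`, choose
alternately `f n` vanishing on the earlier vectors with `F (f n)` a fixed positive number, and `x n`
with `f i (x n)` close to `F (f i)` for all `i ≤ n`. -/
theorem exists_isTriangularSystem [CompleteSpace X] (hX : ¬ IsReflexiveSpace 𝕜 X) :
    ∃ (f : ℕ → StrongDual 𝕜 X) (x : ℕ → X) (R δ : ℝ), IsTriangularSystem f x R δ := by
  classical
  obtain ⟨F, hF⟩ : ∃ F, ∀ y, inclusionInDoubleDual 𝕜 X y ≠ F := by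
    simpa [IsReflexiveSpace, Function.Surjective] using hX
  have hiso : Isometry (inclusionInDoubleDual 𝕜 X) :=
    (inclusionInDoubleDualLi 𝕜 (E := X)).isometry
  -- The image of `X` is closed because `X` is complete, so `F` has positive distance from it.
  have hclosed : IsClosed (Set.range (inclusionInDoubleDual 𝕜 X)) :=
    hiso.isClosedEmbedding.isClosed_range
  obtain ⟨θ, hθ, hball⟩ := Metric.isOpen_iff.1 hclosed.isOpen_compl F
    (by rintro ⟨y, hy⟩; exact hF y hy)
  have hdist : ∀ y : X, θ / 2 < ‖F - inclusionInDoubleDual 𝕜 X y‖ := fun y => by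
    by_contra! h
    refine hball (a := inclusionInDoubleDual 𝕜 X y) ?_ ⟨y, rfl⟩
    exact (mem_ball_iff_norm' (a := F) (b := inclusionInDoubleDual 𝕜 X y)).2
      (h.trans_lt (half_lt_self hθ))
  have hstep : ∀ (f : StrongDual 𝕜 X) (y : X), F f = ((θ / 2 : ℝ) : 𝕜) → ‖f y - F f‖ < θ / 4 →
      θ / 4 ≤ re (f y) := fun f y hf hy => by
    have h1 := (RCLike.abs_re_le_norm (f y - F f)).trans_lt hy
    rw [hf, map_sub, RCLike.ofReal_re] at h1
    linarith [(abs_lt.1 h1).1]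
  obtain ⟨q, hq, hqq⟩ := exists_seq_of_forall_finset_exists
    (fun p : StrongDual 𝕜 X × X => ‖p.1‖ ≤ 1 ∧ F p.1 = ((θ / 2 : ℝ) : 𝕜) ∧ ‖p.2‖ ≤ ‖F‖ ∧
      θ / 4 ≤ re (p.1 p.2))
    (fun p p' => p'.1 p.2 = 0 ∧ θ / 4 ≤ re (p.1 p'.2)) (by
      intro s hs
      obtain ⟨f, hf1, hfF, hfs⟩ := exists_annihilator_apply_eq F (half_pos hθ) hdist
        (s.image Prod.snd)
      obtain ⟨y, hy, hyf⟩ := exists_norm_le_forall_norm_sub_lt F (insert f (s.image Prod.fst))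
        (ε := θ / 4) (by linarith)
      refine ⟨(f, y), ⟨hf1, hfF, hy, hstep f y hfF (hyf f (by simp))⟩, fun p hp => ⟨?_, ?_⟩⟩
      · exact hfs _ (Finset.mem_image_of_mem _ hp)
      · exact hstep _ y (hs p hp).2.1
          (hyf _ (Finset.mem_insert_of_mem (Finset.mem_image_of_mem _ hp))))
  refine ⟨fun n => (q n).1, fun n => (q n).2, ‖F‖, θ / 4, fun n => (hq n).1,
    fun n => (hq n).2.2.1, by linarith, fun k n h => (hqq k n h).1, fun n k h => ?_⟩
  rcases h.lt_or_eq with h | rfl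
  · exact (hqq n k h).2
  · exact (hq n).2.2.2

end TriangularSystem

/-! ### Transfer from `ℓ¹` to the dual -/

section Transfer

variable {𝕜 : Type v} [RCLike 𝕜] {X : Type u} [NormedAddCommGroup X] [NormedSpace 𝕜 X]

open RCLike

/-- The values at `x k` of `∑ n, a n • f n`, for a triangular system: the terms with `n > k` vanish
at `x k`, so the sum over `n ≤ k` is the full one. -/
def partialSums (f : ℕ → StrongDual 𝕜 X) (x : ℕ → X) (a : ℕ → ℝ≥0) (k : ℕ) : 𝕜 :=
  ∑ n ∈ Finset.range (k + 1), ((a n : ℝ) : 𝕜) * f n (x k)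

/-- The functionals that agree on the vectors `x k` with `∑ n, a n • f n` for some `a ∈ C`. -/
def dualLift (f : ℕ → StrongDual 𝕜 X) (x : ℕ → X) (C : Set (ℕ → ℝ≥0)) : Set (WeakDual 𝕜 X) :=
  {g | ∃ a ∈ C, ∀ k, g (x k) = partialSums f x a k}

theorem convex_dualLift (f : ℕ → StrongDual 𝕜 X) (x : ℕ → X) {C : Set (ℕ → ℝ≥0)}
    (hC : Convex ℝ≥0 C) : Convex ℝ (dualLift f x C) := by
  rintro g ⟨a, ha, hga⟩ h ⟨b, hb, hhb⟩ s t hs ht hst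
  lift s to ℝ≥0 using hs
  lift t to ℝ≥0 using ht
  refine ⟨s • a + t • b, hC ha hb zero_le zero_le (by exact_mod_cast hst), fun k => ?_⟩
  change (s : ℝ) • g (x k) + (t : ℝ) • h (x k) = _
  rw [hga, hhb]
  simp only [partialSums, Finset.smul_sum, ← Finset.sum_add_distrib]
  refine Finset.sum_congr rfl fun n _ => ?_
  simp [RCLike.real_smul_eq_coe_mul]
  ring

theorem continuous_partialSums (f : ℕ → StrongDual 𝕜 X) (x : ℕ → X) :
    Continuous (partialSums f x) := by
  refine continuous_pi fun k => continuous_finsetSum _ fun n _ => Continuous.mul ?_ continuous_const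
  exact RCLike.continuous_ofReal.comp (NNReal.continuous_coe.comp (continuous_apply n))

theorem continuous_eval_sequence (x : ℕ → X) :
    Continuous fun (g : WeakDual 𝕜 X) (k : ℕ) => g (x k) :=
  continuous_pi fun k => WeakDual.eval_continuous (x k)

namespace IsTriangularSystem

variable {f : ℕ → StrongDual 𝕜 X} {x : ℕ → X} {R δ : ℝ}

theorem partialSums_injective (h : IsTriangularSystem f x R δ) :
    Function.Injective (partialSums f x) := by
  intro a b hab
  funext k
  induction k using Nat.strong_induction_on with
  | _ k ih =>
    have hk := congr_fun hab k
    have hsum : ∑ n ∈ Finset.range k, ((a n : ℝ) : 𝕜) * f n (x k) =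
        ∑ n ∈ Finset.range k, ((b n : ℝ) : 𝕜) * f n (x k) :=
      Finset.sum_congr rfl fun n hn => by rw [ih n (Finset.mem_range.1 hn)]
    have hne : f k (x k) ≠ 0 := fun h0 => by
      have h1 := h.le_re_apply k k le_rfl
      rw [h0, map_zero] at h1
      exact h1.not_gt h.pos
    simp only [partialSums, Finset.sum_range_succ, hsum] at hk
    exact NNReal.coe_injective (RCLike.ofReal_injective
      (mul_right_cancel₀ hne (add_left_cancel hk)))

/-- The series `∑ n, a n • f n` converges in norm and realizes the values `partialSums f x a`. -/
theorem exists_dual_of_mass_le (h : IsTriangularSystem f x R δ) {a : ℕ → ℝ≥0} {m : ℝ≥0}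
    (ha : mass a ≤ m) : ∃ g : StrongDual 𝕜 X, ‖g‖ ≤ m ∧ ∀ k, g (x k) = partialSums f x a k := by
  have hsum : Summable a := ENNReal.tsum_coe_ne_top_iff_summable.1
    (ne_top_of_le_ne_top ENNReal.coe_ne_top ha)
  have hle : ∀ n, ‖((a n : ℝ) : 𝕜) • f n‖ ≤ a n := fun n => by
    rw [norm_smul, RCLike.norm_ofReal, NNReal.abs_eq]
    exact mul_le_of_le_one_right (a n).2 (h.norm_functional_le n)
  have hsum' : Summable fun n => (a n : ℝ) := NNReal.summable_coe.2 hsum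
  have hf : Summable fun n => ((a n : ℝ) : 𝕜) • f n := Summable.of_norm_bounded hsum' hle
  refine ⟨∑' n, ((a n : ℝ) : 𝕜) • f n, ?_, fun k => ?_⟩
  · refine (tsum_of_norm_bounded hsum'.hasSum hle).trans ?_
    rw [mass, ← ENNReal.coe_tsum hsum] at ha
    rw [← NNReal.coe_tsum]
    exact_mod_cast ha
  · let e : StrongDual 𝕜 X →L[𝕜] 𝕜 := ContinuousLinearMap.apply 𝕜 𝕜 (x k)
    refine (e.map_tsum hf).trans ?_
    change ∑' n, ((a n : ℝ) : 𝕜) * f n (x k) = _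
    refine tsum_eq_sum fun n hn => ?_
    rw [h.apply_eq_zero k n (by have := Finset.mem_range.not.1 hn; omega), mul_zero]

/-- On the positive cone the `ℓ¹`-norm of `a` is controlled by the norm of any functional with the
values `partialSums f x a`, since the real parts of `f n (x k)`, `n ≤ k`, are at least `δ`. -/
theorem mass_le_of_norm_le (h : IsTriangularSystem f x R δ) {a : ℕ → ℝ≥0} {g : StrongDual 𝕜 X}
    {r : ℝ} (hg : ‖g‖ ≤ r) (hga : ∀ k, g (x k) = partialSums f x a k) :
    mass a ≤ ENNReal.ofReal (r * R / δ) := by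
  refine ENNReal.tsum_le_of_sum_range_le fun k => ?_
  have hk : δ * ∑ n ∈ Finset.range (k + 1), (a n : ℝ) ≤ r * R :=
    calc δ * ∑ n ∈ Finset.range (k + 1), (a n : ℝ)
        ≤ ∑ n ∈ Finset.range (k + 1), (a n : ℝ) * re (f n (x k)) := by
          rw [Finset.mul_sum]
          refine Finset.sum_le_sum fun n hn => ?_
          rw [mul_comm]
          exact mul_le_mul_of_nonneg_left
            (h.le_re_apply n k (Nat.lt_succ_iff.1 (Finset.mem_range.1 hn))) (a n).2
      _ = re (g (x k)) := by simp [hga, partialSums]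
      _ ≤ ‖g (x k)‖ := RCLike.re_le_norm _
      _ ≤ ‖g‖ * ‖x k‖ := g.le_opNorm _
      _ ≤ r * R := mul_le_mul hg (h.norm_vector_le k) (norm_nonneg _) ((norm_nonneg _).trans hg)
  rw [← ENNReal.ofNNReal_finsetSum, ENNReal.ofReal, ENNReal.coe_le_coe]
  refine NNReal.le_toNNReal_of_coe_le ?_
  rw [le_div_iff₀' h.pos]
  refine le_trans ?_ hk
  rw [NNReal.coe_sum]
  exact mul_le_mul_of_nonneg_left (Finset.sum_le_sum_of_subset_of_nonneg
    (Finset.range_mono k.le_succ) fun n _ _ => (a n).2) h.pos.le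

/-- `dualLift` turns bounded pointwise limits into weak* derived sets.  The maps `g ↦ (g (x k))` and
`partialSums f x` into the sequence space are continuous, and each carries the bounded sets in
question to relatively compact ones, so that closures may be compared in the sequence space. -/
theorem weakStarDerived_dualLift (h : IsTriangularSystem f x R δ) (C : Set (ℕ → ℝ≥0)) :
    weakStarDerived (dualLift f x C) = dualLift f x (boundedLimits C) := by
  ext g
  constructor
  · intro hg
    obtain ⟨m, hm⟩ := Set.mem_iUnion.1 hg
    obtain ⟨M, hM⟩ := exists_nat_ge ((m : ℝ) * R / δ)
    -- A set of families of mass at most `M` is relatively compact in the product topology.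
    have hcpt : IsCompact (closure (C ∩ {a | mass a ≤ (M : ℝ≥0∞)})) := by
      have hbox : IsCompact (Set.univ.pi fun _ : ℕ => Set.Icc (0 : ℝ≥0) M) :=
        isCompact_univ_pi fun _ => isCompact_Icc
      refine hbox.of_isClosed_subset isClosed_closure
        (closure_minimal ?_ (isClosed_set_pi fun _ _ => isClosed_Icc))
      intro a ha n _
      refine ⟨zero_le, ?_⟩
      have : (a n : ℝ≥0∞) ≤ M := (ENNReal.le_tsum n).trans ha.2
      exact_mod_cast this
    have hsub : dualLift f x C ∩ WeakDual.toStrongDual ⁻¹' Metric.closedBall 0 (m : ℝ) ⊆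
        (fun (g : WeakDual 𝕜 X) (k : ℕ) => g (x k)) ⁻¹'
          (partialSums f x '' closure (C ∩ {a | mass a ≤ (M : ℝ≥0∞)})) := by
      rintro g ⟨⟨a, ha, hga⟩, hgm⟩
      refine ⟨a, subset_closure ⟨ha, ?_⟩, funext fun k => (hga k).symm⟩
      refine (h.mass_le_of_norm_le (mem_closedBall_zero_iff.1 hgm) hga).trans ?_
      exact (ENNReal.ofReal_le_ofReal hM).trans_eq (ENNReal.ofReal_natCast M)
    obtain ⟨a, ha, hga⟩ := closure_minimal hsub
      ((hcpt.image (continuous_partialSums f x)).isClosed.preimage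
        (continuous_eval_sequence x)) hm
    exact ⟨a, Set.mem_iUnion.2 ⟨M, ha⟩, fun k => (congr_fun hga k).symm⟩
  · rintro ⟨a, ha, hga⟩
    obtain ⟨m, hm⟩ := Set.mem_iUnion.1 ha
    let L : Set (WeakDual 𝕜 X) :=
      dualLift f x C ∩ WeakDual.toStrongDual ⁻¹' Metric.closedBall 0 (m : ℝ)
    have hcpt : IsCompact (closure L) :=
      (WeakDual.isCompact_closedBall 0 (m : ℝ)).of_isClosed_subset isClosed_closure
        (closure_minimal Set.inter_subset_right (WeakDual.isClosed_closedBall 0 (m : ℝ)))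
    have hsub : C ∩ {a | mass a ≤ (m : ℝ≥0∞)} ⊆ partialSums f x ⁻¹'
        ((fun (g : WeakDual 𝕜 X) (k : ℕ) => g (x k)) '' closure L) := by
      rintro c ⟨hc, hcm⟩
      obtain ⟨g', hg', hgc⟩ := h.exists_dual_of_mass_le (m := m) (a := c) (by simpa using hcm)
      exact ⟨StrongDual.toWeakDual g', subset_closure ⟨⟨c, hc, hgc⟩,
        mem_closedBall_zero_iff.2 (by simpa using hg')⟩, funext hgc⟩
    obtain ⟨g', hg', hgx⟩ := closure_minimal hsub
      ((hcpt.image (continuous_eval_sequence x)).isClosed.preimage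
        (continuous_partialSums f x)) hm
    -- `g - g'` vanishes on every `x k`, so translation by it preserves `dualLift f x C`.
    have hzero : ∀ k, (g - g') (x k) = 0 := fun k => by
      have : g' (x k) = partialSums f x a k := congr_fun hgx k
      change g (x k) - g' (x k) = 0
      rw [hga, this, sub_self]
    obtain ⟨M, hM⟩ := exists_nat_ge (m + ‖WeakDual.toStrongDual (g - g')‖)
    refine Set.mem_iUnion.2 ⟨M, ?_⟩
    have hmap : Set.MapsTo (fun l => l + (g - g')) L
        (dualLift f x C ∩ WeakDual.toStrongDual ⁻¹' Metric.closedBall 0 (M : ℝ)) := by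
      rintro l ⟨⟨c, hc, hlc⟩, hl⟩
      refine ⟨⟨c, hc, fun k => ?_⟩, mem_closedBall_zero_iff.2 ?_⟩
      · change l (x k) + (g - g') (x k) = _
        rw [hzero, add_zero, hlc]
      · rw [map_add]
        exact (norm_add_le _ _).trans
          ((add_le_add (mem_closedBall_zero_iff.1 hl) le_rfl).trans hM)
    have := hmap.closure (continuous_id.add continuous_const) hg'
    simpa using this

theorem dualLift_injOn (h : IsTriangularSystem f x R δ) {C D : Set (ℕ → ℝ≥0)}
    (hC : ∀ a ∈ C, mass a ≠ ∞) (hD : ∀ a ∈ D, mass a ≠ ∞) (hCD : dualLift f x C = dualLift f x D) :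
    C = D := by
  have aux : ∀ {C D : Set (ℕ → ℝ≥0)}, (∀ a ∈ C, mass a ≠ ∞) → dualLift f x C ⊆ dualLift f x D →
      C ⊆ D := by
    intro C D hC hCD a ha
    obtain ⟨g, -, hg⟩ := h.exists_dual_of_mass_le (ENNReal.coe_toNNReal (hC a ha)).ge
    obtain ⟨b, hb, hgb⟩ := hCD (show StrongDual.toWeakDual g ∈ _ from ⟨a, ha, hg⟩)
    have : a = b := h.partialSums_injective (funext fun k => (hg k).symm.trans (hgb k))
    exact this ▸ hb
  exact (aux hC hCD.le).antisymm (aux hD hCD.ge)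

theorem weakStarDerivedIter_dualLift_tower (h : IsTriangularSystem f x R δ) (n m : ℕ) :
    weakStarDerivedIter (dualLift f x (tower n)) (m : Ordinal.{w}) =
      dualLift f x (tower (n - m)) := by
  induction m with
  | zero => simpa using weakStarDerivedIter_zero (dualLift f x (tower n))
  | succ m ih =>
    rw [Nat.cast_succ, weakStarDerivedIter_add_one, ih, h.weakStarDerived_dualLift]
    rcases hk : n - m with _ | k
    · rw [boundedLimits_tower_zero, show n - (m + 1) = 0 by omega]
    · rw [boundedLimits_tower_succ, show n - (m + 1) = k by omega]

end IsTriangularSystem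

end Transfer

end

/-! ### Convex sets of finite order -/

theorem mainTheorem1 {𝕜 : Type v} [RCLike 𝕜] {X : Type u} [NormedAddCommGroup X]
    [NormedSpace 𝕜 X] [CompleteSpace X] (hX : ¬ IsReflexiveSpace 𝕜 X) (n : ℕ) :
    ∃ B : Set (WeakDual 𝕜 X), Convex ℝ B ∧ HasWeakStarOrder B (n : Ordinal.{max u v}) := by
  obtain ⟨f, x, R, δ, h⟩ := exists_isTriangularSystem hX
  refine ⟨dualLift f x (tower n), convex_dualLift f x (convex_tower n), ?_, fun β hβ => ?_⟩
  · change weakStarDerivedIter _ _ = weakStarDerivedIter _ _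
    rw [← Nat.cast_succ, h.weakStarDerivedIter_dualLift_tower,
      h.weakStarDerivedIter_dualLift_tower]
    simp
  · by_contra! hlt
    obtain ⟨m, rfl⟩ := Ordinal.lt_omega0.1 (hlt.trans (Ordinal.natCast_lt_omega0 n))
    have hmn : m < n := by exact_mod_cast hlt
    change weakStarDerivedIter _ _ = weakStarDerivedIter _ _ at hβ
    rw [← Nat.cast_succ, h.weakStarDerivedIter_dualLift_tower,
      h.weakStarDerivedIter_dualLift_tower] at hβ
    have heq := h.dualLift_injOn (fun a ha => ha.1) (fun a ha => ha.1) hβ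
    obtain ⟨k, hk⟩ : ∃ k, n - m = k + 1 := ⟨n - m - 1, by omega⟩
    rw [hk, show n - (m + 1) = k by omega] at heq
    exact tower_succ_ne k heq
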